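/- Let $\mathcal P(r)$ be the manifold of symmetric positive definite real $r\times r$ matrices with tangent spaces $T_x\mathcal P(r)=\mathrm{Sym}(r)$ and the affine-invariant Riemannian metric $\langle\eta_1,\eta_2\rangle_x=\operatorname{tr}(\eta_1x^{-1}\eta_2x^{-1})$. Let $x,z\in\mathcal P(r)$ with $x\neq z$, let $T=d_{\mathcal P}(x,z)=\|\operatorname{Log}(x^{-1/2}zx^{-1/2})\|$ (Frobenius norm) be their geodesic distance, and let $\gamma$ be the unit speed geodesic with $\gamma(0)=x$ and $\gamma(T)=z$. Put $\upsilon=\dot\gamma(0)$ and let $v_1,\dots,v_r$ be an orthonormal basis of $\mathbb R^r$ and $\lambda_1,\dots,\lambda_r$ real numbers with $$x^{-1/2}\,\upsilon\,x^{-1/2}=\sum_{i=1}^r\lambda_i v_iv_i^{\mathrm T}.$$ For $1\le i\le j\le r$ let $$\xi_{ij}=\begin{cases}\tfrac12\,x^{1/2}(v_iv_j^{\mathrm T}+v_jv_i^{\mathrm T})x^{1/2}, & i=j,\\[1ex] \tfrac1{\sqrt2}\,x^{1/2}(v_iv_j^{\mathrm T}+v_jv_i^{\mathrm T})x^{1/2},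 & i\ne j,\end{cases}$$ and let $\Xi_{ij}$ be the parallel vector field along $\gamma$ (with respect to the Levi-Civita connection) with $\Xi_{ij}(0)=\xi_{ij}$. Let $c(y)$ denote the midpoint of the geodesic joining $y\in\mathcal P(r)$ and $z$. Then $c$ is differentiable at $x$, and for all $1\le i\le j\le r$ its differential satisfies $$D_xc[\xi_{ij}]=\begin{cases}\tfrac12\,\Xi_{ij}(\tfrac T2), & \lambda_i=\lambda_j,\\[1ex] \dfrac{\sinh\left(\frac T4|\lambda_i-\lambda_j|\right)}{\sinh\left(\frac T2|\lambda_i-\lambda_j|\right)}\,\Xi_{ij}(\tfrac T2), & \lambda_i\neq\lambda_j.\end{cases}$$ -/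

import Mathlib

/-- The affine-invariant Riemannian metric on the manifold `P(r)` of symmetric positive definite
`r × r` matrices: `⟨η, ζ⟩_x = tr (η x⁻¹ ζ x⁻¹)`.  `P(r)` is an open subset of the vector space
`Sym(r)` of symmetric matrices, so its tangent space at every point is `Sym(r)`. -/
noncomputable def spdMetric {r : ℕ} (x η ζ : Matrix (Fin r) (Fin r) ℝ) : ℝ :=
  (η * x⁻¹ * ζ * x⁻¹).trace

/-- `Γ` is the Christoffel form (in the global chart `P(r) ⊆ Sym(r)`) of the Levi-Civita
connection of the affine-invariant metric, i.e. `∇_η Z = DZ[η] + Γ_x(η, Z)`: it takes symmetric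
values, is torsion-free, and is compatible with the metric. -/
structure IsSpdLeviCivita {r : ℕ}
    (Γ : Matrix (Fin r) (Fin r) ℝ → Matrix (Fin r) (Fin r) ℝ → Matrix (Fin r) (Fin r) ℝ →
      Matrix (Fin r) (Fin r) ℝ) : Prop where
  symm_valued : ∀ x η ζ, x.PosDef → η.IsSymm → ζ.IsSymm → (Γ x η ζ).IsSymm
  torsion_free : ∀ x η ζ, x.PosDef → η.IsSymm → ζ.IsSymm → Γ x η ζ = Γ x ζ η
  metric : ∀ x η ζ θ, x.PosDef → η.IsSymm → ζ.IsSymm → θ.IsSymm →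
    HasDerivAt (fun s : ℝ => spdMetric (x + s • η) ζ θ)
      (spdMetric x (Γ x η ζ) θ + spdMetric x ζ (Γ x η θ)) 0

/-- The Christoffel form of the Levi-Civita connection of the affine-invariant metric; see
`isSpdLeviCivita_spdChristoffel` and `IsSpdLeviCivita.eq_spdChristoffel`. -/
noncomputable def spdChristoffel {r : ℕ} (x η ζ : Matrix (Fin r) (Fin r) ℝ) :
    Matrix (Fin r) (Fin r) ℝ :=
  -((1 / 2 : ℝ) • (η * x⁻¹ * ζ + ζ * x⁻¹ * η))

theorem spdMetric_comm {r : ℕ} (x η ζ : Matrix (Fin r) (Fin r) ℝ) :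
    spdMetric x η ζ = spdMetric x ζ η := by
  unfold spdMetric
  rw [Matrix.mul_assoc (η * x⁻¹), Matrix.trace_mul_comm, ← Matrix.mul_assoc]

open scoped MatrixOrder Matrix.Norms.L2Operator in
theorem eq_zero_of_spdMetric_self {r : ℕ} {x η : Matrix (Fin r) (Fin r) ℝ} (hx : x.PosDef)
    (hη : η.IsSymm) (h : spdMetric x η η = 0) : η = 0 := by
  obtain ⟨B, hxB⟩ := CStarAlgebra.nonneg_iff_eq_star_mul_self.1 hx.inv.posSemidef.nonneg
  rw [Matrix.star_eq_conjTranspose] at hxB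
  have hB : IsUnit B := isUnit_of_mul_isUnit_right (x := B.conjTranspose) (hxB ▸ hx.inv.isUnit)
  have h1 : ((B * η * B.conjTranspose).conjTranspose * (B * η * B.conjTranspose)).trace = 0 := by
    have hs : η.conjTranspose = η := by
      rw [Matrix.conjTranspose_eq_transpose_of_trivial]
      exact hη
    rw [spdMetric, hxB] at h
    rw [← h, Matrix.conjTranspose_mul, Matrix.conjTranspose_mul, hs,
      Matrix.conjTranspose_conjTranspose, Matrix.trace_mul_comm]
    simp only [Matrix.mul_assoc]
    rw [Matrix.trace_mul_comm]
    simp only [Matrix.mul_assoc]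
  rw [Matrix.trace_conjTranspose_mul_self_eq_zero_iff] at h1
  have hB2 : IsUnit B.conjTranspose := hB.star
  rw [hB2.mul_left_eq_zero, hB.mul_right_eq_zero] at h1
  exact h1

section LeviCivita

attribute [local instance] Matrix.linftyOpNormedRing Matrix.linftyOpNormedAlgebra

/-- `spdChristoffel` is the Christoffel form of the Levi-Civita connection. -/
theorem isSpdLeviCivita_spdChristoffel {r : ℕ} :
    IsSpdLeviCivita (spdChristoffel (r := r)) where
  symm_valued x η ζ hx hη hζ := by
    have hx' : x.transpose = x := by simpa using hx.1.eq
    unfold Matrix.IsSymm at *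
    simp [spdChristoffel, Matrix.transpose_mul, Matrix.transpose_nonsing_inv, hx', hη, hζ,
      Matrix.mul_assoc, add_comm]
  torsion_free x η ζ _ _ _ := by
    simp [spdChristoffel, add_comm]
  metric x η ζ θ hx hη hζ hθ := by
    have hu : IsUnit x := hx.isUnit
    obtain ⟨u, rfl⟩ := hu
    have h1 : HasDerivAt (fun s : ℝ => (u : Matrix (Fin r) (Fin r) ℝ) + s • η) η 0 := by
      have := ((hasDerivAt_id (0 : ℝ)).smul_const η).const_add (u : Matrix (Fin r) (Fin r) ℝ)
      rw [one_smul] at this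
      exact this
    have h2 := (hasFDerivAt_ringInverse (𝕜 := ℝ) u)
    have h3 : HasDerivAt (fun s : ℝ => ((u : Matrix (Fin r) (Fin r) ℝ) + s • η)⁻¹)
        (-((u : Matrix (Fin r) (Fin r) ℝ)⁻¹ * η * (u : Matrix (Fin r) (Fin r) ℝ)⁻¹)) 0 := by
      have h4 := HasFDerivAt.comp_hasDerivAt_of_eq (0 : ℝ) h2 h1 (by simp)
      simp [Function.comp_def, ← Matrix.nonsing_inv_eq_ringInverse] at h4
      exact h4
    have h5 := ((h3.const_mul ζ).mul (h3.const_mul θ))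
    have h6 := ((Matrix.traceLinearMap (Fin r) ℝ ℝ).toContinuousLinearMap.hasFDerivAt).comp_hasDerivAt
      (0 : ℝ) h5
    refine (h6.congr_deriv ?_).congr_of_eventuallyEq (.of_forall fun s => ?_)
    · change Matrix.trace (_ : Matrix (Fin r) (Fin r) ℝ) = _
      simp only [spdMetric, spdChristoffel, zero_smul, add_zero]
      set y := (u : Matrix (Fin r) (Fin r) ℝ)⁻¹
      have hc : (η * (y * (ζ * (y * (θ * y))))).trace = (ζ * (y * (θ * (y * (η * y))))).trace := by
        have := Matrix.trace_mul_comm (η * y) (ζ * y * θ * y)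
        simpa only [Matrix.mul_assoc] using this
      simp only [mul_neg, neg_mul, add_mul, mul_add, smul_mul_assoc, mul_smul_comm,
        Matrix.trace_add, Matrix.trace_neg, Matrix.trace_smul, smul_eq_mul, Matrix.mul_assoc,
        smul_add]
      linarith
    · simp [spdMetric, Matrix.mul_assoc]

/-- The Levi-Civita connection is unique. -/
theorem IsSpdLeviCivita.eq_spdChristoffel {r : ℕ}
    {Γ : Matrix (Fin r) (Fin r) ℝ → Matrix (Fin r) (Fin r) ℝ → Matrix (Fin r) (Fin r) ℝ →
      Matrix (Fin r) (Fin r) ℝ} (h : IsSpdLeviCivita Γ) {x η ζ : Matrix (Fin r) (Fin r) ℝ}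
    (hx : x.PosDef) (hη : η.IsSymm) (hζ : ζ.IsSymm) : Γ x η ζ = spdChristoffel x η ζ := by
  have h0 := isSpdLeviCivita_spdChristoffel (r := r)
  have hsub : ∀ a b c : Matrix (Fin r) (Fin r) ℝ,
      spdMetric x (a - b) c = spdMetric x a c - spdMetric x b c := by
    intro a b c
    simp [spdMetric, sub_mul, Matrix.trace_sub]
  have key : ∀ a b c : Matrix (Fin r) (Fin r) ℝ, a.IsSymm → b.IsSymm → c.IsSymm →
      spdMetric x (Γ x a b - spdChristoffel x a b) c =
        -spdMetric x (Γ x a c - spdChristoffel x a c) b := by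
    intro a b c ha hb hc
    have := (h.metric x a b c hx ha hb hc).unique (h0.metric x a b c hx ha hb hc)
    rw [hsub, hsub]
    rw [spdMetric_comm x b, spdMetric_comm x b] at this
    linarith
  have tf : ∀ a b : Matrix (Fin r) (Fin r) ℝ, a.IsSymm → b.IsSymm →
      Γ x a b - spdChristoffel x a b = Γ x b a - spdChristoffel x b a := by
    intro a b ha hb
    rw [h.torsion_free x a b hx ha hb, h0.torsion_free x a b hx ha hb]
  have hs : (Γ x η ζ - spdChristoffel x η ζ).IsSymm :=
    (h.symm_valued x η ζ hx hη hζ).sub (h0.symm_valued x η ζ hx hη hζ)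
  refine sub_eq_zero.1 (eq_zero_of_spdMetric_self hx hs ?_)
  generalize hθ : Γ x η ζ - spdChristoffel x η ζ = θ at hs
  have e1 := key η ζ θ hη hζ hs
  have e2 := key θ η ζ hs hη hζ
  have e3 := key ζ θ η hζ hs hη
  rw [tf η θ hη hs] at e1
  rw [tf θ ζ hs hζ] at e2
  rw [tf ζ η hζ hη] at e3
  rw [hθ] at e1 e3
  linarith

end LeviCivita

/-- The covariant derivative `(D/dt) V` of a vector field `V` along a curve `γ` in `P(r)`. -/
noncomputable def spdCovDeriv {r : ℕ} (γ V : ℝ → Matrix (Fin r) (Fin r) ℝ) (t : ℝ) :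
    Matrix (Fin r) (Fin r) ℝ :=
  deriv V t + spdChristoffel (γ t) (deriv γ t) (V t)

/-- `γ` is a geodesic of `P(r)`.  The manifold is complete, so geodesics are parametrized by
the whole real line; they have constant, possibly zero, speed. -/
structure IsSpdGeodesic {r : ℕ} (γ : ℝ → Matrix (Fin r) (Fin r) ℝ) : Prop where
  posDef : ∀ t, (γ t).PosDef
  differentiable : Differentiable ℝ γ
  differentiable_deriv : Differentiable ℝ (deriv γ)
  covDeriv_eq_zero : ∀ t, spdCovDeriv γ (deriv γ) t = 0

/-- `V` is a parallel (tangent) vector field along the curve `γ` in `P(r)`. -/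
structure IsSpdParallel {r : ℕ} (γ V : ℝ → Matrix (Fin r) (Fin r) ℝ) : Prop where
  symm : ∀ t, (V t).IsSymm
  differentiable : Differentiable ℝ V
  covDeriv_eq_zero : ∀ t, spdCovDeriv γ V t = 0

/-- `P_t(ξ)`: the value at time `t` of the parallel field along `γ` that starts at `ξ`. -/
noncomputable def spdParallelTransport {r : ℕ} (γ : ℝ → Matrix (Fin r) (Fin r) ℝ)
    (ξ : Matrix (Fin r) (Fin r) ℝ) : ℝ → Matrix (Fin r) (Fin r) ℝ :=
  Classical.epsilon fun V => IsSpdParallel γ V ∧ V 0 = ξ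

/-- The square root `x^{1/2}` of a positive definite matrix. -/
noncomputable def spdSqrt {r : ℕ} (x : Matrix (Fin r) (Fin r) ℝ) : Matrix (Fin r) (Fin r) ℝ :=
  cfc Real.sqrt x

/-- The logarithm of a positive definite matrix. -/
noncomputable def spdLog {r : ℕ} (x : Matrix (Fin r) (Fin r) ℝ) : Matrix (Fin r) (Fin r) ℝ :=
  cfc Real.log x

/-- The geodesic distance `d(x, z) = ‖Log (x^{-1/2} z x^{-1/2})‖` (Frobenius norm). -/
noncomputable def spdDist {r : ℕ} (x z : Matrix (Fin r) (Fin r) ℝ) : ℝ :=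
  Real.sqrt (∑ i, ∑ j, (spdLog ((spdSqrt x)⁻¹ * z * (spdSqrt x)⁻¹)) i j ^ 2)

/-- The unit speed geodesic `γ` joining `x` and `z ≠ x`: `γ 0 = x` and `γ T = z` for the
geodesic distance `T` of `x` and `z`. -/
noncomputable def spdGeodesic {r : ℕ} (x z : Matrix (Fin r) (Fin r) ℝ) :
    ℝ → Matrix (Fin r) (Fin r) ℝ :=
  Classical.epsilon fun γ => IsSpdGeodesic γ ∧
    (∀ t, spdMetric (γ t) (deriv γ t) (deriv γ t) = 1) ∧ γ 0 = x ∧ γ (spdDist x z) = z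

/-- The midpoint `c(x, z)` of the geodesic joining `x` and `z` (here on the unit interval, which
also covers `x = z`). -/
noncomputable def spdMidpoint {r : ℕ} (x z : Matrix (Fin r) (Fin r) ℝ) :
    Matrix (Fin r) (Fin r) ℝ :=
  Classical.epsilon fun m => ∃ γ : ℝ → Matrix (Fin r) (Fin r) ℝ,
    IsSpdGeodesic γ ∧ γ 0 = x ∧ γ 1 = z ∧ γ (1 / 2) = m

/-- The tangent vector `ξ_ij` at `x` built from the vectors `v_1, …, v_r`:
`x^{1/2} (½ (v_i v_iᵀ + v_i v_iᵀ)) x^{1/2}` for `i = j` and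
`x^{1/2} ((1/√2) (v_i v_jᵀ + v_j v_iᵀ)) x^{1/2}` for `i ≠ j`. -/
noncomputable def spdFrame {r : ℕ} (x : Matrix (Fin r) (Fin r) ℝ)
    (v : Fin r → EuclideanSpace ℝ (Fin r)) (i j : Fin r) : Matrix (Fin r) (Fin r) ℝ :=
  spdSqrt x *
    ((if i = j then (1 / 2 : ℝ) else 1 / Real.sqrt 2) •
      (Matrix.vecMulVec (v i) (v j) + Matrix.vecMulVec (v j) (v i))) * spdSqrt x

/-!
Along a geodesic `γ` of `P(r)` the matrix `H = ½ γ⁻¹ γ'` is constant, and a field `V` along `γ` is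
parallel if and only if `V' = Hᵀ V + V H`. Hence the congruences `η ↦ exp(tH)ᵀ η exp(tH)` carry out
parallel transport along `γ`, and also move `γ 0` to `γ t`.

The midpoint `m` of `y` and `z` is the only positive definite solution of `m z⁻¹ m = y`, so the
differential of `y ↦ m` is the inverse of `k ↦ k z⁻¹ m + m z⁻¹ k`. For `y = γ 0` and `z = γ T` one
has `z⁻¹ m = exp(-TH)`. If `Hᵀ u = α u` and `Hᵀ w = β w`, it follows that this operator maps the
parallel transport of `u wᵀ + w uᵀ` to `2 cosh(T/2 (α - β)) (u wᵀ + w uᵀ)`. The vectors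
`x^{1/2} v_i` are such eigenvectors, with eigenvalues `λ_i / 2`.
-/

open scoped Matrix MatrixOrder Matrix.Norms.L2Operator

open NormedSpace (exp)

section BanachAlgebra

variable {𝔸 : Type*} [NormedRing 𝔸] [NormedAlgebra ℝ 𝔸]

theorem exp_smul_algebraMap (t c : ℝ) :
    exp (t • algebraMap ℝ 𝔸 c) = algebraMap ℝ 𝔸 (Real.exp (t * c)) := by
  rw [Real.exp_eq_exp_ℝ, NormedSpace.algebraMap_exp_comm, Algebra.algebraMap_eq_smul_one,
    Algebra.algebraMap_eq_smul_one, smul_smul]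

variable [CompleteSpace 𝔸]

theorem exp_add_smul (a : 𝔸) (s t : ℝ) : exp ((s + t) • a) = exp (s • a) * exp (t • a) := by
  let _ := NormedAlgebra.restrictScalars ℚ ℝ 𝔸
  rw [add_smul, NormedSpace.exp_add_of_commute (((Commute.refl a).smul_left s).smul_right t)]

theorem semiconjBy_exp_smul {x a b : 𝔸} (h : SemiconjBy x a b) (t : ℝ) :
    SemiconjBy x (exp (t • a)) (exp (t • b)) := by
  let _ := NormedAlgebra.restrictScalars ℚ ℝ 𝔸
  exact (h.smul_right t).exp_right

theorem exp_smul_mul_mul_exp_smul_of_eigen {a x b : 𝔸} {α β : ℝ} (ha : a * x = α • x)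
    (hb : x * b = β • x) (s t : ℝ) :
    exp (s • a) * x * exp (t • b) = Real.exp (s * α + t * β) • x := by
  have exp_mul : exp (s • a) * x = Real.exp (s * α) • x := by
    have semiconj : SemiconjBy x (algebraMap ℝ 𝔸 α) a := by
      rw [SemiconjBy, ha, ← Algebra.commutes, ← Algebra.smul_def]
    rw [← (semiconjBy_exp_smul semiconj s).eq, exp_smul_algebraMap, ← Algebra.commutes,
      ← Algebra.smul_def]
  have mul_exp : x * exp (t • b) = Real.exp (t * β) • x := by
    have semiconj : SemiconjBy x b (algebraMap ℝ 𝔸 β) := by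
      rw [SemiconjBy, hb, ← Algebra.smul_def]
    rw [(semiconjBy_exp_smul semiconj t).eq, exp_smul_algebraMap, ← Algebra.smul_def]
  rw [exp_mul, smul_mul_assoc, mul_exp, smul_smul, Real.exp_add]

theorem hasDerivAt_exp_smul_mul_mul_exp_smul (b x a : 𝔸) (t : ℝ) :
    HasDerivAt (fun t : ℝ => exp (t • b) * x * exp (t • a))
      (b * (exp (t • b) * x * exp (t • a)) + exp (t • b) * x * exp (t • a) * a) t := by
  refine (((hasDerivAt_exp_smul_const' b t).mul_const x).mul
    (hasDerivAt_exp_smul_const a t)).congr_deriv ?_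
  simp only [mul_assoc]

theorem eq_exp_smul_mul_mul_exp_smul {b a : 𝔸} {V : ℝ → 𝔸}
    (hV : ∀ t, HasDerivAt V (b * V t + V t * a) t) (t : ℝ) :
    V t = exp (t • b) * V 0 * exp (t • a) := by
  have pulledBack_deriv : ∀ t, HasDerivAt (fun t : ℝ => exp (t • -b) * V t * exp (t • -a)) 0 t := by
    intro t
    refine (((hasDerivAt_exp_smul_const (-b) t).mul (hV t)).mul
      (hasDerivAt_exp_smul_const' (-a) t)).congr_deriv ?_
    simp only [Pi.mul_apply]
    noncomm_ring
  have pulledBack_const := is_const_of_deriv_eq_zero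
    (fun t => (pulledBack_deriv t).differentiableAt) (fun t => (pulledBack_deriv t).deriv) t 0
  have exp_mul_exp_neg : ∀ c : 𝔸, exp (t • c) * exp (t • -c) = 1 := by
    intro c
    rw [smul_neg, ← neg_smul, ← exp_add_smul, add_neg_cancel, zero_smul, NormedSpace.exp_zero]
  simp only [zero_smul, NormedSpace.exp_zero, one_mul, mul_one] at pulledBack_const
  calc V t = exp (t • b) * exp (t • -b) * V t * (exp (t • -a) * exp (t • - -a)) := by
        rw [exp_mul_exp_neg, exp_mul_exp_neg, one_mul, mul_one]
    _ = exp (t • b) * V 0 * exp (t • a) := by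
        rw [neg_neg, ← pulledBack_const]
        noncomm_ring

end BanachAlgebra

section Matrix

variable {n : Type*}

theorem isSymm_of_posDef {x : Matrix n n ℝ} (hx : x.PosDef) : x.IsSymm :=
  Matrix.isHermitian_iff_isSymm.1 hx.isHermitian

variable [Fintype n]

theorem sum_smul_vecMulVec_mulVec {ι : Type*} [Fintype ι] (lam : ι → ℝ)
    {v : ι → EuclideanSpace ℝ n} (hv : Orthonormal ℝ v) (i : ι) :
    (∑ k, lam k • Matrix.vecMulVec (v k) (v k)) *ᵥ v i = lam i • (v i).ofLp := by
  classical
  have dotProduct_eq (k : ι) : (v k).ofLp ⬝ᵥ (v i).ofLp = if i = k then 1 else 0 := by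
    rw [← orthonormal_iff_ite.1 hv i k, EuclideanSpace.inner_eq_star_dotProduct, star_trivial]
  simp [Matrix.sum_mulVec, Matrix.smul_mulVec, Matrix.vecMulVec_mulVec, dotProduct_eq]

theorem exists_isUnit_eq_transpose_mul_self [DecidableEq n] {P : Matrix n n ℝ} (hP : P.PosDef) :
    ∃ A : Matrix n n ℝ, IsUnit A ∧ P = Aᵀ * A := by
  simpa only [Matrix.star_eq_conjTranspose, Matrix.conjTranspose_eq_transpose_of_trivial] using
    CStarAlgebra.isStrictlyPositive_iff_eq_star_mul_self.1 hP.isStrictlyPositive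

theorem trace_transpose_mul_mul_mul_pos {P Q k : Matrix n n ℝ} (hP : P.PosDef) (hQ : Q.PosDef)
    (hk : k ≠ 0) : 0 < (kᵀ * P * k * Q).trace := by
  classical
  obtain ⟨A, hA, rfl⟩ := exists_isUnit_eq_transpose_mul_self hP
  obtain ⟨B, hB, rfl⟩ := exists_isUnit_eq_transpose_mul_self hQ
  have trace_eq : (kᵀ * (Aᵀ * A) * k * (Bᵀ * B)).trace = ((A * k * Bᵀ)ᴴ * (A * k * Bᵀ)).trace := by
    rw [← mul_assoc _ Bᵀ B, Matrix.trace_mul_comm]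
    simp only [Matrix.conjTranspose_eq_transpose_of_trivial, Matrix.transpose_mul,
      Matrix.transpose_transpose, mul_assoc]
  have conj_ne_zero : A * k * Bᵀ ≠ 0 := by
    rwa [Ne, ((Matrix.isUnit_transpose B).2 hB).mul_left_eq_zero, hA.mul_right_eq_zero]
  rw [trace_eq]
  exact (Matrix.posSemidef_conjTranspose_mul_self _).trace_nonneg.lt_of_ne'
    (Matrix.trace_conjTranspose_mul_self_eq_zero_iff.not.2 conj_ne_zero)

variable [DecidableEq n]

theorem hasDerivAt_matrix_inv {γ : ℝ → Matrix n n ℝ} {γ' : Matrix n n ℝ} {t : ℝ}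
    (h : HasDerivAt γ γ' t) (hu : IsUnit (γ t)) :
    HasDerivAt (fun t => (γ t)⁻¹) (-((γ t)⁻¹ * γ' * (γ t)⁻¹)) t := by
  obtain ⟨u, hu⟩ := hu
  have inverse_deriv :=
    HasFDerivAt.comp_hasDerivAt_of_eq t (hasFDerivAt_ringInverse (𝕜 := ℝ) u) h hu
  simp only [Function.comp_def, ← Matrix.nonsing_inv_eq_ringInverse] at inverse_deriv
  refine inverse_deriv.congr_deriv ?_
  simp [← hu]

/-- The derivative `k ↦ k p m + m p k` at `m` of the quadratic map `m ↦ m p m`, of which the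
midpoint map `y ↦ spdMidpoint y z` is a right inverse for `p = z⁻¹`. -/
noncomputable def quadDeriv (p m : Matrix n n ℝ) : Matrix n n ℝ →L[ℝ] Matrix n n ℝ :=
  (ContinuousLinearMap.mul ℝ _).flip (p * m) + ContinuousLinearMap.mul ℝ _ (m * p)

theorem quadDeriv_apply (p m k : Matrix n n ℝ) : quadDeriv p m k = k * (p * m) + m * p * k := rfl

theorem hasFDerivAt_mul_mul_self (p m : Matrix n n ℝ) :
    HasFDerivAt (fun m => m * p * m) (quadDeriv p m) m := by
  refine (((hasFDerivAt_id m).mul_const' p).mul' (hasFDerivAt_id m)).congr_fderiv ?_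
  ext1 k
  simp [quadDeriv_apply, mul_assoc, add_comm]

theorem quadDeriv_injective {p m : Matrix n n ℝ} (hp : p.PosDef) (hm : m.PosDef) :
    Function.Injective (quadDeriv p m) := by
  refine (injective_iff_map_eq_zero _).2 fun k hk => by_contra fun hk0 => ?_
  have hdet := (Matrix.isUnit_iff_isUnit_det m).1 hm.isUnit
  have trace_eq : (kᵀ * m⁻¹ * quadDeriv p m k * m⁻¹).trace =
      (kᵀ * m⁻¹ * k * p).trace + (kᵀ * p * k * m⁻¹).trace := by
    rw [quadDeriv_apply, mul_add, add_mul, Matrix.trace_add]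
    congr 2
    · simp only [mul_assoc, Matrix.mul_nonsing_inv _ hdet, mul_one]
    · simp only [mul_assoc, Matrix.nonsing_inv_mul_cancel_left _ _ hdet]
  rw [hk, mul_zero, zero_mul, Matrix.trace_zero] at trace_eq
  linarith [trace_transpose_mul_mul_mul_pos hm.inv hp hk0,
    trace_transpose_mul_mul_mul_pos hp hm.inv hk0]

/-- `quadDeriv p m` as a continuous linear equivalence; its inverse is the differential of the
midpoint map. -/
noncomputable def quadDerivEquiv {p m : Matrix n n ℝ} (hp : p.PosDef) (hm : m.PosDef) :
    Matrix n n ℝ ≃L[ℝ] Matrix n n ℝ :=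
  (LinearEquiv.ofInjectiveEndo (quadDeriv p m).toLinearMap
    (quadDeriv_injective hp hm)).toContinuousLinearEquiv

theorem coe_quadDerivEquiv {p m : Matrix n n ℝ} (hp : p.PosDef) (hm : m.PosDef) :
    (quadDerivEquiv hp hm : Matrix n n ℝ →L[ℝ] Matrix n n ℝ) = quadDeriv p m := rfl

/-- The congruence `η ↦ exp(tH)ᵀ η exp(tH)`. When `Hᵀ x = x H`, these are the transvections along
the geodesic through `x` with velocity `2 x H`: they move `x` along that geodesic, and tangent
vectors at `x` by parallel transport. -/
noncomputable def transvection (H : Matrix n n ℝ) (t : ℝ) (η : Matrix n n ℝ) : Matrix n n ℝ :=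
  exp (t • Hᵀ) * η * exp (t • H)

theorem transvection_eq (H : Matrix n n ℝ) (t : ℝ) (η : Matrix n n ℝ) :
    transvection H t η = (exp (t • H))ᵀ * η * exp (t • H) := by
  rw [transvection, ← Matrix.transpose_smul, Matrix.exp_transpose]

theorem transvection_zero (H η : Matrix n n ℝ) : transvection H 0 η = η := by
  simp [transvection]

theorem transvection_smul_left (c : ℝ) (H : Matrix n n ℝ) (t : ℝ) (η : Matrix n n ℝ) :
    transvection (c • H) t η = transvection H (t * c) η := by
  simp only [transvection, Matrix.transpose_smul, smul_smul]

theorem isSymm_transvection {η : Matrix n n ℝ} (hη : η.IsSymm) (H : Matrix n n ℝ) (t : ℝ) :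
    (transvection H t η).IsSymm := by
  rw [transvection_eq, Matrix.IsSymm, Matrix.transpose_mul, Matrix.transpose_mul,
    Matrix.transpose_transpose, hη.eq, mul_assoc]

theorem posDef_transvection {x : Matrix n n ℝ} (hx : x.PosDef) (H : Matrix n n ℝ) (t : ℝ) :
    (transvection H t x).PosDef := by
  rw [transvection_eq, ← Matrix.conjTranspose_eq_transpose_of_trivial]
  exact hx.conjTranspose_mul_mul_same (Matrix.mulVec_injective_of_isUnit (Matrix.isUnit_exp _))

theorem hasDerivAt_transvection (H η : Matrix n n ℝ) (t : ℝ) :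
    HasDerivAt (fun t => transvection H t η)
      (Hᵀ * transvection H t η + transvection H t η * H) t :=
  hasDerivAt_exp_smul_mul_mul_exp_smul Hᵀ η H t

theorem eq_transvection_of_hasDerivAt {H : Matrix n n ℝ} {V : ℝ → Matrix n n ℝ}
    (hV : ∀ t, HasDerivAt V (Hᵀ * V t + V t * H) t) (t : ℝ) : V t = transvection H t (V 0) :=
  eq_exp_smul_mul_mul_exp_smul hV t

theorem semiconjBy_transvection {x H : Matrix n n ℝ} (h : SemiconjBy x H Hᵀ) (t : ℝ) :
    SemiconjBy (transvection H t x) H Hᵀ := by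
  have exp_comm (K : Matrix n n ℝ) : SemiconjBy (exp (t • K)) K K :=
    (semiconjBy_exp_smul (Commute.refl K) t).symm
  exact ((exp_comm Hᵀ).mul_left h).mul_left (exp_comm H)

theorem transvection_eq_mul_exp {x H : Matrix n n ℝ} (h : SemiconjBy x H Hᵀ) (t : ℝ) :
    transvection H t x = x * exp ((2 * t) • H) := by
  rw [transvection, ← (semiconjBy_exp_smul h t).eq, mul_assoc, ← exp_add_smul, two_mul]

theorem exp_mul_vecMulVec_mul_exp {H : Matrix n n ℝ} {u w : n → ℝ} {α β : ℝ}
    (hu : Hᵀ *ᵥ u = α • u) (hw : Hᵀ *ᵥ w = β • w) (s t : ℝ) :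
    exp (s • Hᵀ) * Matrix.vecMulVec u w * exp (t • H) =
      Real.exp (s * α + t * β) • Matrix.vecMulVec u w := by
  refine exp_smul_mul_mul_exp_smul_of_eigen ?_ ?_ s t
  · rw [Matrix.mul_vecMulVec, hu, Matrix.smul_vecMulVec]
  · rw [Matrix.vecMulVec_mul, ← Matrix.mulVec_transpose, hw, Matrix.vecMulVec_smul]

end Matrix

section SquareRootAndLogarithm

variable {r : ℕ} {x : Matrix (Fin r) (Fin r) ℝ}

theorem spdSqrt_eq_sqrt (hx : x.PosDef) : spdSqrt x = CFC.sqrt x := by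
  rw [CFC.sqrt_eq_real_sqrt x hx.posSemidef.nonneg, cfcₙ_eq_cfc, spdSqrt]

theorem spdSqrt_mul_self (hx : x.PosDef) : spdSqrt x * spdSqrt x = x := by
  rw [spdSqrt_eq_sqrt hx, CFC.sqrt_mul_sqrt_self x hx.posSemidef.nonneg]

theorem posDef_spdSqrt (hx : x.PosDef) : (spdSqrt x).PosDef := by
  rw [spdSqrt_eq_sqrt hx]
  exact Matrix.isStrictlyPositive_iff_posDef.1 (IsStrictlyPositive.sqrt x hx.isStrictlyPositive)

theorem posDef_inv_spdSqrt_conj {z : Matrix (Fin r) (Fin r) ℝ} (hx : x.PosDef) (hz : z.PosDef) :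
    ((spdSqrt x)⁻¹ * z * (spdSqrt x)⁻¹).PosDef := by
  have hs := (posDef_spdSqrt hx).inv
  simpa only [hs.isHermitian.eq] using
    hz.conjTranspose_mul_mul_same (Matrix.mulVec_injective_of_isUnit hs.isUnit)

theorem exp_spdLog (hx : x.PosDef) : exp (spdLog x) = x :=
  CFC.exp_log x hx.isStrictlyPositive

theorem isSymm_spdLog (x : Matrix (Fin r) (Fin r) ℝ) : (spdLog x).IsSymm :=
  Matrix.isHermitian_iff_isSymm.1 (cfc_predicate Real.log x)

theorem spdDist_sq (x z : Matrix (Fin r) (Fin r) ℝ) :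
    spdDist x z ^ 2 = (spdLog ((spdSqrt x)⁻¹ * z * (spdSqrt x)⁻¹) *
      spdLog ((spdSqrt x)⁻¹ * z * (spdSqrt x)⁻¹)).trace := by
  rw [spdDist, Real.sq_sqrt (by positivity)]
  simp only [Matrix.trace, Matrix.diag, Matrix.mul_apply]
  refine Finset.sum_congr rfl fun i _ => Finset.sum_congr rfl fun j _ => ?_
  rw [(isSymm_spdLog _).apply i j, sq]

end SquareRootAndLogarithm

section Geodesic

variable {r : ℕ} {x z H : Matrix (Fin r) (Fin r) ℝ} {γ : ℝ → Matrix (Fin r) (Fin r) ℝ}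

theorem spdMetric_two_smul_mul (hx : x.PosDef) (H : Matrix (Fin r) (Fin r) ℝ) :
    spdMetric x ((2 : ℝ) • (x * H)) ((2 : ℝ) • (x * H)) = 4 * (H * H).trace := by
  have hdet := (Matrix.isUnit_iff_isUnit_det x).1 hx.isUnit
  have trace_eq : (x * H * x⁻¹ * (x * H) * x⁻¹).trace = (H * H).trace := by
    rw [Matrix.trace_mul_comm]
    simp only [mul_assoc, Matrix.nonsing_inv_mul_cancel_left _ _ hdet]
  simp only [spdMetric, smul_mul_assoc, mul_smul_comm, smul_smul, Matrix.trace_smul, trace_eq,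
    smul_eq_mul]
  norm_num

theorem spdCovDeriv_eq_deriv_sub {t : ℝ} (hγ : (γ t).PosDef) (hH : SemiconjBy (γ t) H Hᵀ)
    (hd : deriv γ t = (2 : ℝ) • (γ t * H)) (V : ℝ → Matrix (Fin r) (Fin r) ℝ) :
    spdCovDeriv γ V t = deriv V t - (Hᵀ * V t + V t * H) := by
  have hdet := (Matrix.isUnit_iff_isUnit_det _).1 hγ.isUnit
  have deriv_mul_inv : deriv γ t * (γ t)⁻¹ = (2 : ℝ) • Hᵀ := by
    rw [hd, hH.eq, smul_mul_assoc, Matrix.mul_nonsing_inv_cancel_right _ _ hdet]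
  have inv_mul_deriv : (γ t)⁻¹ * deriv γ t = (2 : ℝ) • H := by
    rw [hd, mul_smul_comm, Matrix.nonsing_inv_mul_cancel_left _ _ hdet]
  rw [spdCovDeriv, spdChristoffel, mul_assoc (V t), deriv_mul_inv, inv_mul_deriv, smul_mul_assoc,
    mul_smul_comm, ← smul_add, smul_smul, ← sub_eq_add_neg]
  norm_num

theorem hasDerivAt_transvection_of_semiconjBy (hH : SemiconjBy x H Hᵀ) (t : ℝ) :
    HasDerivAt (fun t => transvection H t x) ((2 : ℝ) • (transvection H t x * H)) t :=
  (hasDerivAt_transvection H x t).congr_deriv <| by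
    rw [← (semiconjBy_transvection hH t).eq, two_smul]

theorem isSpdGeodesic_transvection (hx : x.PosDef) (hH : SemiconjBy x H Hᵀ) :
    IsSpdGeodesic (fun t => transvection H t x) := by
  have deriv_eq : deriv (fun t => transvection H t x) =
      fun t => (2 : ℝ) • (transvection H t x * H) :=
    funext fun t => (hasDerivAt_transvection_of_semiconjBy hH t).deriv
  have velocity_deriv (t : ℝ) := ((hasDerivAt_transvection H x t).mul_const H).const_smul (2 : ℝ)
  refine ⟨posDef_transvection hx H, fun t => (hasDerivAt_transvection H x t).differentiableAt,
    fun t => ?_, fun t => ?_⟩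
  · rw [deriv_eq]
    exact (velocity_deriv t).differentiableAt
  · rw [spdCovDeriv_eq_deriv_sub (posDef_transvection hx H t) (semiconjBy_transvection hH t)
      (congrFun deriv_eq t), deriv_eq]
    refine sub_eq_zero.2 ((velocity_deriv t).deriv.trans ?_)
    simp only [add_mul, smul_add, mul_smul_comm, smul_mul_assoc, mul_assoc]

theorem exists_generator (hx : x.PosDef) (hz : z.PosDef) :
    ∃ H : Matrix (Fin r) (Fin r) ℝ, SemiconjBy x H Hᵀ ∧ transvection H 1 x = z ∧
      4 * (H * H).trace = spdDist x z ^ 2 := by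
  have hs := posDef_spdSqrt hx
  have hdet := (Matrix.isUnit_iff_isUnit_det _).1 hs.isUnit
  have exp_log := exp_spdLog (posDef_inv_spdSqrt_conj hx hz)
  have hL := isSymm_spdLog ((spdSqrt x)⁻¹ * z * (spdSqrt x)⁻¹)
  have dist_sq := spdDist_sq x z
  have sqrt_mul := spdSqrt_mul_self hx
  set s := spdSqrt x
  set L := spdLog (s⁻¹ * z * s⁻¹)
  have mul_eq : x * (s⁻¹ * L * s) = s * L * s := by
    simp only [← sqrt_mul, mul_assoc, Matrix.mul_nonsing_inv_cancel_left _ _ hdet]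
  have semiconj : SemiconjBy x ((1 / 2 : ℝ) • (s⁻¹ * L * s)) ((1 / 2 : ℝ) • (s⁻¹ * L * s))ᵀ := by
    have mul_isSymm : (x * (s⁻¹ * L * s)).IsSymm := by
      rw [mul_eq, Matrix.IsSymm, Matrix.transpose_mul, Matrix.transpose_mul, hL.eq,
        (isSymm_of_posDef hs).eq, mul_assoc]
    rw [Matrix.transpose_smul]
    refine SemiconjBy.smul_right ?_ _
    rw [SemiconjBy, ← mul_isSymm.eq, Matrix.transpose_mul, (isSymm_of_posDef hx).eq]
  refine ⟨_, semiconj, ?_, ?_⟩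
  · rw [transvection_eq_mul_exp semiconj, smul_smul, mul_one, mul_one_div_cancel two_ne_zero,
      one_smul, Matrix.exp_conj' _ _ hs.isUnit, exp_log, ← sqrt_mul]
    simp only [mul_assoc, Matrix.mul_nonsing_inv_cancel_left _ _ hdet,
      Matrix.nonsing_inv_mul _ hdet, mul_one]
  · have trace_eq : (s⁻¹ * L * s * (s⁻¹ * L * s)).trace = (L * L).trace := by
      rw [mul_assoc, mul_assoc, Matrix.trace_mul_comm]
      simp only [mul_assoc, Matrix.mul_nonsing_inv_cancel_left _ _ hdet,
        Matrix.mul_nonsing_inv _ hdet, mul_one]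
    rw [smul_mul_smul_comm, Matrix.trace_smul, trace_eq, ← dist_sq, smul_eq_mul]
    ring

theorem exists_geodesic (hx : x.PosDef) (hz : z.PosDef) :
    ∃ γ, IsSpdGeodesic γ ∧ γ 0 = x ∧ γ 1 = z := by
  obtain ⟨H, hH, rfl, -⟩ := exists_generator hx hz
  exact ⟨_, isSpdGeodesic_transvection hx hH, transvection_zero H x, rfl⟩

theorem spdDist_ne_zero (hx : x.PosDef) (hz : z.PosDef) (hxz : x ≠ z) : spdDist x z ≠ 0 := by
  obtain ⟨H, hH, transvection_eq, trace_eq⟩ := exists_generator hx hz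
  intro dist_eq
  have velocity_isSymm : ((2 : ℝ) • (x * H)).IsSymm := by
    rw [Matrix.IsSymm, Matrix.transpose_smul, Matrix.transpose_mul, (isSymm_of_posDef hx).eq, hH.eq]
  have velocity_eq_zero : (2 : ℝ) • (x * H) = 0 :=
    eq_zero_of_spdMetric_self hx velocity_isSymm <| by
      rw [spdMetric_two_smul_mul hx, trace_eq, dist_eq, sq, zero_mul]
  have H_eq_zero : H = 0 :=
    hx.isUnit.mul_right_eq_zero.1 ((smul_eq_zero_iff_right two_ne_zero).1 velocity_eq_zero)
  exact hxz (by simpa [H_eq_zero, transvection] using transvection_eq)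

theorem exists_unit_speed_geodesic (hx : x.PosDef) (hz : z.PosDef) (hxz : x ≠ z) :
    ∃ γ, IsSpdGeodesic γ ∧ (∀ t, spdMetric (γ t) (deriv γ t) (deriv γ t) = 1) ∧
      γ 0 = x ∧ γ (spdDist x z) = z := by
  obtain ⟨H, hH, transvection_eq, trace_eq⟩ := exists_generator hx hz
  have dist_ne_zero := spdDist_ne_zero hx hz hxz
  have smul_semiconj : SemiconjBy x ((spdDist x z)⁻¹ • H) ((spdDist x z)⁻¹ • H)ᵀ := by
    rw [Matrix.transpose_smul]
    exact hH.smul_right _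
  refine ⟨_, isSpdGeodesic_transvection hx smul_semiconj, fun t => ?_, transvection_zero _ x, ?_⟩
  · rw [(hasDerivAt_transvection_of_semiconjBy smul_semiconj t).deriv,
      spdMetric_two_smul_mul (posDef_transvection hx _ t), smul_mul_smul_comm, Matrix.trace_smul,
      smul_eq_mul, mul_left_comm, trace_eq]
    field_simp
  · rw [transvection_smul_left, mul_inv_cancel₀ dist_ne_zero, transvection_eq]

theorem spdGeodesic_spec (hx : x.PosDef) (hz : z.PosDef) (hxz : x ≠ z) :
    IsSpdGeodesic (spdGeodesic x z) ∧
      (∀ t, spdMetric (spdGeodesic x z t) (deriv (spdGeodesic x z) t)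
        (deriv (spdGeodesic x z) t) = 1) ∧
      spdGeodesic x z 0 = x ∧ spdGeodesic x z (spdDist x z) = z :=
  Classical.epsilon_spec (exists_unit_speed_geodesic hx hz hxz)

/-- Half of the constant logarithmic derivative `γ⁻¹ γ'` of a geodesic `γ`; with this
normalization `γ t = transvection H t (γ 0)` for `H = spdGenerator γ`. -/
noncomputable def spdGenerator (γ : ℝ → Matrix (Fin r) (Fin r) ℝ) : Matrix (Fin r) (Fin r) ℝ :=
  (1 / 2 : ℝ) • ((γ 0)⁻¹ * deriv γ 0)

namespace IsSpdGeodesic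

theorem deriv_deriv (h : IsSpdGeodesic γ) (t : ℝ) :
    deriv (deriv γ) t = deriv γ t * (γ t)⁻¹ * deriv γ t := by
  have covDeriv_eq := h.covDeriv_eq_zero t
  rw [spdCovDeriv, spdChristoffel, ← two_smul ℝ, smul_smul, one_div_mul_cancel two_ne_zero,
    one_smul] at covDeriv_eq
  exact eq_of_sub_eq_zero (by rwa [sub_eq_add_neg])

theorem deriv_eq (h : IsSpdGeodesic γ) (t : ℝ) :
    deriv γ t = (2 : ℝ) • (γ t * spdGenerator γ) := by
  have logDeriv_deriv (t : ℝ) : HasDerivAt (fun t => (γ t)⁻¹ * deriv γ t) 0 t := by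
    refine ((hasDerivAt_matrix_inv (h.differentiable t).hasDerivAt (h.posDef t).isUnit).mul
      (h.differentiable_deriv t).hasDerivAt).congr_deriv ?_
    rw [h.deriv_deriv]
    noncomm_ring
  have logDeriv_const := is_const_of_deriv_eq_zero
    (fun t => (logDeriv_deriv t).differentiableAt) (fun t => (logDeriv_deriv t).deriv) t 0
  rw [spdGenerator, mul_smul_comm, smul_smul, mul_one_div_cancel two_ne_zero, one_smul,
    ← logDeriv_const, Matrix.mul_nonsing_inv_cancel_left _ _
      ((Matrix.isUnit_iff_isUnit_det _).1 (h.posDef t).isUnit)]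

theorem isSymm_deriv (h : IsSpdGeodesic γ) (t : ℝ) : (deriv γ t).IsSymm := by
  have star_eq : (fun t => star (γ t)) = γ := funext fun t => (h.posDef t).isHermitian
  have deriv_star := deriv.star (f := γ) (x := t)
  rw [star_eq] at deriv_star
  exact Matrix.isHermitian_iff_isSymm.1 deriv_star.symm

theorem semiconjBy_spdGenerator (h : IsSpdGeodesic γ) (t : ℝ) :
    SemiconjBy (γ t) (spdGenerator γ) (spdGenerator γ)ᵀ := by
  have velocity_isSymm := (h.isSymm_deriv t).eq
  rw [h.deriv_eq, Matrix.transpose_smul, Matrix.transpose_mul,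
    (isSymm_of_posDef (h.posDef t)).eq] at velocity_isSymm
  exact (smul_right_injective _ two_ne_zero velocity_isSymm).symm

theorem eq_transvection (h : IsSpdGeodesic γ) (t : ℝ) :
    γ t = transvection (spdGenerator γ) t (γ 0) := by
  refine eq_transvection_of_hasDerivAt (fun t => ?_) t
  refine (h.differentiable t).hasDerivAt.congr_deriv ?_
  rw [h.deriv_eq, two_smul, ← (h.semiconjBy_spdGenerator t).eq]

theorem apply_add (h : IsSpdGeodesic γ) (s t : ℝ) :
    γ (s + t) = γ s * exp ((2 * t) • spdGenerator γ) := by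
  have eq_mul_exp (t : ℝ) : γ t = γ 0 * exp ((2 * t) • spdGenerator γ) := by
    rw [h.eq_transvection t, transvection_eq_mul_exp (h.semiconjBy_spdGenerator 0)]
  rw [eq_mul_exp, eq_mul_exp s, mul_assoc, mul_add, exp_add_smul]

theorem inv_mul_apply_half (h : IsSpdGeodesic γ) (T : ℝ) :
    (γ T)⁻¹ * γ (T / 2) = exp (-T • spdGenerator γ) := by
  have half_eq := h.apply_add T (-T / 2)
  rw [show T + -T / 2 = T / 2 by ring, mul_div_cancel₀ _ two_ne_zero] at half_eq
  rw [half_eq, Matrix.nonsing_inv_mul_cancel_left _ _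
    ((Matrix.isUnit_iff_isUnit_det _).1 (h.posDef T).isUnit)]

theorem apply_half_mul_inv (h : IsSpdGeodesic γ) (T : ℝ) :
    γ (T / 2) * (γ T)⁻¹ = exp (-T • (spdGenerator γ)ᵀ) := by
  rw [← Matrix.transpose_smul, Matrix.exp_transpose, ← h.inv_mul_apply_half, Matrix.transpose_mul,
    (isSymm_of_posDef (h.posDef _)).eq, (isSymm_of_posDef (h.posDef T).inv).eq]

theorem apply_half_mul_inv_mul_apply_half (h : IsSpdGeodesic γ) (T : ℝ) :
    γ (T / 2) * (γ T)⁻¹ * γ (T / 2) = γ 0 := by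
  rw [mul_assoc, h.inv_mul_apply_half]
  have zero_eq := h.apply_add (T / 2) (-T / 2)
  rw [mul_div_cancel₀ _ two_ne_zero] at zero_eq
  rw [← zero_eq, ← add_div, add_neg_cancel, zero_div]

theorem spdCovDeriv_eq (h : IsSpdGeodesic γ) (V : ℝ → Matrix (Fin r) (Fin r) ℝ) (t : ℝ) :
    spdCovDeriv γ V t = deriv V t - ((spdGenerator γ)ᵀ * V t + V t * spdGenerator γ) :=
  spdCovDeriv_eq_deriv_sub (h.posDef t) (h.semiconjBy_spdGenerator t) (h.deriv_eq t) V

theorem isSpdParallel_transvection (h : IsSpdGeodesic γ) {ξ : Matrix (Fin r) (Fin r) ℝ}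
    (hξ : ξ.IsSymm) : IsSpdParallel γ (fun t => transvection (spdGenerator γ) t ξ) where
  symm := isSymm_transvection hξ _
  differentiable t := (hasDerivAt_transvection _ ξ t).differentiableAt
  covDeriv_eq_zero t := by
    rw [h.spdCovDeriv_eq, (hasDerivAt_transvection _ ξ t).deriv, sub_self]

theorem eq_transvection_of_isSpdParallel (h : IsSpdGeodesic γ)
    {V : ℝ → Matrix (Fin r) (Fin r) ℝ} (hV : IsSpdParallel γ V) (t : ℝ) :
    V t = transvection (spdGenerator γ) t (V 0) := by
  refine eq_transvection_of_hasDerivAt (fun t => ?_) t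
  refine (hV.differentiable t).hasDerivAt.congr_deriv ?_
  rw [← sub_eq_zero, ← h.spdCovDeriv_eq, hV.covDeriv_eq_zero]

theorem spdParallelTransport_eq (h : IsSpdGeodesic γ) {ξ : Matrix (Fin r) (Fin r) ℝ}
    (hξ : ξ.IsSymm) (t : ℝ) :
    spdParallelTransport γ ξ t = transvection (spdGenerator γ) t ξ := by
  obtain ⟨isParallel, initial⟩ : IsSpdParallel γ (spdParallelTransport γ ξ) ∧
      spdParallelTransport γ ξ 0 = ξ :=
    Classical.epsilon_spec (p := fun V => IsSpdParallel γ V ∧ V 0 = ξ)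
      ⟨_, h.isSpdParallel_transvection hξ, transvection_zero _ ξ⟩
  rw [h.eq_transvection_of_isSpdParallel isParallel, initial]

end IsSpdGeodesic

end Geodesic

section Midpoint

variable {r : ℕ} {x y z m : Matrix (Fin r) (Fin r) ℝ} {γ : ℝ → Matrix (Fin r) (Fin r) ℝ}

theorem spdMidpoint_spec (hy : y.PosDef) (hz : z.PosDef) :
    (spdMidpoint y z).PosDef ∧ spdMidpoint y z * z⁻¹ * spdMidpoint y z = y := by
  obtain ⟨γ₀, hγ₀, γ₀_zero, γ₀_one⟩ := exists_geodesic hy hz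
  obtain ⟨γ, hγ, rfl, rfl, half_eq⟩ : ∃ γ : ℝ → Matrix (Fin r) (Fin r) ℝ,
      IsSpdGeodesic γ ∧ γ 0 = y ∧ γ 1 = z ∧ γ (1 / 2) = spdMidpoint y z :=
    Classical.epsilon_spec (p := fun m => ∃ γ : ℝ → Matrix (Fin r) (Fin r) ℝ,
      IsSpdGeodesic γ ∧ γ 0 = y ∧ γ 1 = z ∧ γ (1 / 2) = m) ⟨_, γ₀, hγ₀, γ₀_zero, γ₀_one, rfl⟩
  rw [← half_eq]
  exact ⟨hγ.posDef _, hγ.apply_half_mul_inv_mul_apply_half 1⟩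

theorem eq_spdSqrt_mul_sqrt_mul (hz : z.PosDef) (hm : m.PosDef) (h : m * z⁻¹ * m = y) :
    m = spdSqrt z * CFC.sqrt ((spdSqrt z)⁻¹ * y * (spdSqrt z)⁻¹) * spdSqrt z := by
  have hdet := (Matrix.isUnit_iff_isUnit_det _).1 (posDef_spdSqrt hz).isUnit
  have sqrt_eq : CFC.sqrt ((spdSqrt z)⁻¹ * y * (spdSqrt z)⁻¹) =
      (spdSqrt z)⁻¹ * m * (spdSqrt z)⁻¹ := by
    refine CFC.sqrt_unique ?_ (posDef_inv_spdSqrt_conj hz hm).posSemidef.nonneg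
    have inv_eq : z⁻¹ = (spdSqrt z)⁻¹ * (spdSqrt z)⁻¹ := by
      rw [← Matrix.mul_inv_rev, spdSqrt_mul_self hz]
    rw [← h, inv_eq]
    noncomm_ring
  rw [sqrt_eq]
  simp only [mul_assoc, Matrix.mul_nonsing_inv_cancel_left _ _ hdet,
    Matrix.nonsing_inv_mul _ hdet, mul_one]

theorem spdMidpoint_eq_spdSqrt_mul_sqrt_mul (hy : y.PosDef) (hz : z.PosDef) :
    spdMidpoint y z = spdSqrt z * CFC.sqrt ((spdSqrt z)⁻¹ * y * (spdSqrt z)⁻¹) * spdSqrt z :=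
  eq_spdSqrt_mul_sqrt_mul hz (spdMidpoint_spec hy hz).1 (spdMidpoint_spec hy hz).2

theorem IsSpdGeodesic.spdMidpoint_eq (h : IsSpdGeodesic γ) (T : ℝ) :
    spdMidpoint (γ 0) (γ T) = γ (T / 2) := by
  rw [spdMidpoint_eq_spdSqrt_mul_sqrt_mul (h.posDef 0) (h.posDef T),
    ← eq_spdSqrt_mul_sqrt_mul (h.posDef T) (h.posDef _) (h.apply_half_mul_inv_mul_apply_half T)]

theorem continuousOn_spdMidpoint (hz : z.PosDef) :
    ContinuousOn (fun y => spdMidpoint y z) {y | y.PosDef} := by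
  have sqrt_continuousOn :
      ContinuousOn (fun y => CFC.sqrt ((spdSqrt z)⁻¹ * y * (spdSqrt z)⁻¹)) {y | y.PosDef} :=
    CFC.continuousOn_sqrt.comp (by fun_prop) fun y hy =>
      (posDef_inv_spdSqrt_conj hz hy).posSemidef.nonneg
  exact ((continuousOn_const.mul sqrt_continuousOn).mul continuousOn_const).congr fun y hy =>
    spdMidpoint_eq_spdSqrt_mul_sqrt_mul hy hz

theorem hasFDerivWithinAt_spdMidpoint (hx : x.PosDef) (hz : z.PosDef) :
    HasFDerivWithinAt (fun y => spdMidpoint y z)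
      ((quadDerivEquiv hz.inv (spdMidpoint_spec hx hz).1).symm :
        Matrix (Fin r) (Fin r) ℝ →L[ℝ] Matrix (Fin r) (Fin r) ℝ) {y | y.PosDef} x := by
  refine HasFDerivWithinAt.of_local_left_inverse (t := Set.univ)
    (f := fun m => m * z⁻¹ * m) ?_ ?_ hx ?_
  · rw [nhdsWithin_univ]
    exact continuousOn_spdMidpoint hz x hx
  · rw [coe_quadDerivEquiv]
    exact (hasFDerivAt_mul_mul_self z⁻¹ (spdMidpoint x z)).hasFDerivWithinAt
  · filter_upwards [self_mem_nhdsWithin] with y hy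
    exact (spdMidpoint_spec hy hz).2

theorem IsSpdGeodesic.quadDeriv_transvection (h : IsSpdGeodesic γ) (T : ℝ) {u w : Fin r → ℝ}
    {α β : ℝ} (hu : (spdGenerator γ)ᵀ *ᵥ u = α • u) (hw : (spdGenerator γ)ᵀ *ᵥ w = β • w) :
    quadDeriv (γ T)⁻¹ (γ (T / 2)) (transvection (spdGenerator γ) (T / 2)
        (Matrix.vecMulVec u w + Matrix.vecMulVec w u)) =
      (2 * Real.cosh (T / 2 * (α - β))) • (Matrix.vecMulVec u w + Matrix.vecMulVec w u) := by
  have exp_half (K : Matrix (Fin r) (Fin r) ℝ) :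
      exp ((T / 2) • K) * exp (-T • K) = exp ((-(T / 2)) • K) ∧
        exp (-T • K) * exp ((T / 2) • K) = exp ((-(T / 2)) • K) := by
    constructor <;> rw [← exp_add_smul] <;> ring_nf
  have two_mul_cosh : 2 * Real.cosh (T / 2 * (α - β)) =
      Real.exp (T / 2 * α + -(T / 2) * β) + Real.exp (T / 2 * β + -(T / 2) * α) := by
    rw [Real.cosh_eq]
    ring_nf
  rw [quadDeriv_apply, h.inv_mul_apply_half, h.apply_half_mul_inv, transvection,
    mul_assoc _ (exp _) (exp _), ← mul_assoc (exp _), ← mul_assoc (exp _), (exp_half _).1,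
    (exp_half _).2]
  simp only [mul_add, add_mul, exp_mul_vecMulVec_mul_exp hu hw, exp_mul_vecMulVec_mul_exp hw hu]
  rw [two_mul_cosh, add_comm (-(T / 2) * α), add_comm (-(T / 2) * β)]
  module

theorem IsSpdGeodesic.exists_hasFDerivWithinAt_spdMidpoint (h : IsSpdGeodesic γ) (T : ℝ) :
    ∃ D : Matrix (Fin r) (Fin r) ℝ →L[ℝ] Matrix (Fin r) (Fin r) ℝ,
      HasFDerivWithinAt (fun y => spdMidpoint y (γ T)) D {y | y.PosDef} (γ 0) ∧
      ∀ (u w : Fin r → ℝ) (α β : ℝ), (spdGenerator γ)ᵀ *ᵥ u = α • u →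
        (spdGenerator γ)ᵀ *ᵥ w = β • w →
        D (Matrix.vecMulVec u w + Matrix.vecMulVec w u) =
          (2 * Real.cosh (T / 2 * (α - β)))⁻¹ •
            spdParallelTransport γ (Matrix.vecMulVec u w + Matrix.vecMulVec w u) (T / 2) := by
  refine ⟨_, hasFDerivWithinAt_spdMidpoint (h.posDef 0) (h.posDef T),
    fun u w α β hu hw => ?_⟩
  have field_isSymm : (Matrix.vecMulVec u w + Matrix.vecMulVec w u).IsSymm := by
    rw [Matrix.IsSymm, Matrix.transpose_add, Matrix.transpose_vecMulVec,
      Matrix.transpose_vecMulVec, add_comm]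
  have two_cosh_ne_zero : 2 * Real.cosh (T / 2 * (α - β)) ≠ 0 :=
    (mul_pos two_pos (Real.cosh_pos _)).ne'
  rw [h.spdParallelTransport_eq field_isSymm, eq_inv_smul_iff₀ two_cosh_ne_zero, ← map_smul,
    ← h.quadDeriv_transvection T hu hw]
  simp only [← h.spdMidpoint_eq T]
  exact (quadDerivEquiv _ _).symm_apply_apply _

end Midpoint

section Frame

variable {r : ℕ}

theorem exists_spdFrame_eq {x : Matrix (Fin r) (Fin r) ℝ} (hx : x.PosDef)
    (v : Fin r → EuclideanSpace ℝ (Fin r)) (i j : Fin r) :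
    ∃ c : ℝ, spdFrame x v i j =
      Matrix.vecMulVec (c • spdSqrt x *ᵥ v i) (spdSqrt x *ᵥ v j) +
        Matrix.vecMulVec (spdSqrt x *ᵥ v j) (c • spdSqrt x *ᵥ v i) := by
  refine ⟨if i = j then 1 / 2 else 1 / √2, ?_⟩
  have sqrt_isSymm := (isSymm_of_posDef (posDef_spdSqrt hx)).eq
  rw [spdFrame, mul_smul_comm, smul_mul_assoc, mul_add, add_mul]
  simp only [Matrix.mul_vecMulVec, Matrix.vecMulVec_mul, ← Matrix.mulVec_transpose, sqrt_isSymm,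
    Matrix.smul_vecMulVec, Matrix.vecMulVec_smul, smul_add]

theorem IsSpdGeodesic.transpose_spdGenerator_mulVec {γ : ℝ → Matrix (Fin r) (Fin r) ℝ}
    (h : IsSpdGeodesic γ) {u : Fin r → ℝ} {μ : ℝ}
    (hu : ((spdSqrt (γ 0))⁻¹ * deriv γ 0 * (spdSqrt (γ 0))⁻¹) *ᵥ u = μ • u) :
    (spdGenerator γ)ᵀ *ᵥ (spdSqrt (γ 0) *ᵥ u) = (μ / 2) • spdSqrt (γ 0) *ᵥ u := by
  have hdet := (Matrix.isUnit_iff_isUnit_det _).1 (posDef_spdSqrt (h.posDef 0)).isUnit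
  have inv_eq : (γ 0)⁻¹ = (spdSqrt (γ 0))⁻¹ * (spdSqrt (γ 0))⁻¹ := by
    rw [← Matrix.mul_inv_rev, spdSqrt_mul_self (h.posDef 0)]
  have generator_mul : (spdGenerator γ)ᵀ * spdSqrt (γ 0) = (1 / 2 : ℝ) •
      (spdSqrt (γ 0) * ((spdSqrt (γ 0))⁻¹ * deriv γ 0 * (spdSqrt (γ 0))⁻¹)) := by
    rw [spdGenerator, Matrix.transpose_smul, Matrix.transpose_mul, (h.isSymm_deriv 0).eq,
      (isSymm_of_posDef (h.posDef 0).inv).eq, inv_eq]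
    simp only [smul_mul_assoc, mul_assoc, Matrix.mul_nonsing_inv_cancel_left _ _ hdet,
      Matrix.nonsing_inv_mul _ hdet, mul_one]
  rw [Matrix.mulVec_mulVec, generator_mul, Matrix.smul_mulVec, ← Matrix.mulVec_mulVec, hu,
    Matrix.mulVec_smul, smul_smul, one_div_mul_eq_div]

theorem IsSpdGeodesic.exists_hasFDerivWithinAt_spdMidpoint_spdFrame
    {γ : ℝ → Matrix (Fin r) (Fin r) ℝ} (h : IsSpdGeodesic γ) (T : ℝ) (lam : Fin r → ℝ)
    (v : OrthonormalBasis (Fin r) ℝ (EuclideanSpace ℝ (Fin r)))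
    (hv : (spdSqrt (γ 0))⁻¹ * deriv γ 0 * (spdSqrt (γ 0))⁻¹ =
      ∑ i, lam i • Matrix.vecMulVec (v i) (v i)) :
    ∃ D : Matrix (Fin r) (Fin r) ℝ →L[ℝ] Matrix (Fin r) (Fin r) ℝ,
      HasFDerivWithinAt (fun y => spdMidpoint y (γ T)) D {y | y.PosDef} (γ 0) ∧
      ∀ i j : Fin r, D (spdFrame (γ 0) v i j) =
        (2 * Real.cosh (T / 4 * (lam i - lam j)))⁻¹ •
          spdParallelTransport γ (spdFrame (γ 0) v i j) (T / 2) := by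
  obtain ⟨D, hasFDerivWithinAt, D_eq⟩ := h.exists_hasFDerivWithinAt_spdMidpoint T
  refine ⟨D, hasFDerivWithinAt, fun i j => ?_⟩
  have eigenvector (i : Fin r) : (spdGenerator γ)ᵀ *ᵥ (spdSqrt (γ 0) *ᵥ v i) =
      (lam i / 2) • spdSqrt (γ 0) *ᵥ v i :=
    h.transpose_spdGenerator_mulVec (by rw [hv, sum_smul_vecMulVec_mulVec lam v.orthonormal])
  obtain ⟨c, frame_eq⟩ := exists_spdFrame_eq (h.posDef 0) v i j
  have smul_eigenvector : (spdGenerator γ)ᵀ *ᵥ (c • spdSqrt (γ 0) *ᵥ v i) =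
      (lam i / 2) • c • spdSqrt (γ 0) *ᵥ v i := by
    rw [Matrix.mulVec_smul, eigenvector, smul_comm]
  rw [frame_eq, D_eq _ _ _ _ smul_eigenvector (eigenvector j),
    show T / 2 * (lam i / 2 - lam j / 2) = T / 4 * (lam i - lam j) by ring]

theorem inv_two_mul_cosh_eq_sinh_div_sinh {a : ℝ} (ha : a ≠ 0) :
    (2 * Real.cosh a)⁻¹ = Real.sinh |a| / Real.sinh (2 * |a|) := by
  have sinh_ne_zero : Real.sinh |a| ≠ 0 := Real.sinh_ne_zero.2 (abs_ne_zero.2 ha)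
  have cosh_ne_zero := (Real.cosh_pos a).ne'
  rw [Real.sinh_two_mul, Real.cosh_abs]
  field_simp

end Frame

theorem corollary3p8 {r : ℕ} (x z : Matrix (Fin r) (Fin r) ℝ) (hx : x.PosDef) (hz : z.PosDef)
    (hxz : x ≠ z)
    (lam : Fin r → ℝ) (v : OrthonormalBasis (Fin r) ℝ (EuclideanSpace ℝ (Fin r)))
    (hv : (spdSqrt x)⁻¹ * deriv (spdGeodesic x z) 0 * (spdSqrt x)⁻¹ =
      ∑ i, lam i • Matrix.vecMulVec (v i) (v i)) :
    ∃ D : Matrix (Fin r) (Fin r) ℝ →L[ℝ] Matrix (Fin r) (Fin r) ℝ,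
      HasFDerivWithinAt (fun y => spdMidpoint y z) D {y | y.PosDef} x ∧
      ∀ i j : Fin r, i ≤ j →
        (lam i = lam j →
          D (spdFrame x v i j) =
            (1 / 2 : ℝ) •
              spdParallelTransport (spdGeodesic x z) (spdFrame x v i j) (spdDist x z / 2)) ∧
        (lam i ≠ lam j →
          D (spdFrame x v i j) =
            (Real.sinh (spdDist x z / 4 * |lam i - lam j|) /
                Real.sinh (spdDist x z / 2 * |lam i - lam j|)) •
              spdParallelTransport (spdGeodesic x z) (spdFrame x v i j) (spdDist x z / 2)) := by
  obtain ⟨hγ, -, start_eq, end_eq⟩ := spdGeodesic_spec hx hz hxz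
  obtain ⟨D, hasFDerivWithinAt, D_eq⟩ :=
    hγ.exists_hasFDerivWithinAt_spdMidpoint_spdFrame (spdDist x z) lam v (by rwa [start_eq])
  rw [start_eq, end_eq] at hasFDerivWithinAt
  rw [start_eq] at D_eq
  refine ⟨D, hasFDerivWithinAt, fun i j _ => ⟨fun hlam => ?_, fun hlam => ?_⟩⟩
  · rw [D_eq, hlam, sub_self, mul_zero, Real.cosh_zero, mul_one, one_div]
  · have dist_nonneg : 0 ≤ spdDist x z := Real.sqrt_nonneg _
    have arg_ne_zero : spdDist x z / 4 * (lam i - lam j) ≠ 0 :=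
      mul_ne_zero (div_ne_zero (spdDist_ne_zero hx hz hxz) four_ne_zero) (sub_ne_zero.2 hlam)
    have abs_arg : |spdDist x z / 4 * (lam i - lam j)| = spdDist x z / 4 * |lam i - lam j| := by
      rw [abs_mul, abs_of_nonneg (div_nonneg dist_nonneg four_pos.le)]
    rw [D_eq, inv_two_mul_cosh_eq_sinh_div_sinh arg_ne_zero, abs_arg, ← mul_assoc,
      show 2 * (spdDist x z / 4) = spdDist x z / 2 by ring]
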